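/- Let $\Bbbk$ be a field; all algebras are associative unital $\Bbbk$-algebras, not necessarily commutative, and all homomorphisms, automorphisms and derivations are $\Bbbk$-linear. **Definitions.** For an automorphism $\sigma$ of an algebra $R$ and a $\sigma$-derivation $\delta$ of $R$ (that is, $\delta(ab)=\sigma(a)\delta(b)+\delta(a)b$), the Ore extension $R[t;\sigma,\delta]$ is the algebra containing $R$ and an element $t$ that is a free left $R$-module with basis $1,t,t^2,\dots$ and satisfies $tr=\sigma(r)t+\delta(r)$ for $r\in R$. An $n$-step iterated Ore extension $A[t_1;\sigma_1,\delta_1]\cdots[t_n;\sigma_n,\delta_n]$ of $A$ is obtained by setting $A_0=A$ and $A_i=A_{i-1}[t_i;\sigma_i,\delta_i]$, where $\sigma_i$ is an algebra automorphism of $A_{i-1}$ and $\delta_i$ is a $\sigma_i$-derivation of $A_{i-1}$. An automorphism $\sigma$ of $R$ is *locally algebraic* if every finite dimensional subspace of $R$ is contained in a $\sigma$-stable finite dimensional subspace of $R$. An algebra $A$ is *strongly $\sigma$-algebraically cancellative* if, for every $n\ge 1$ and every algebra $A'$, the existence of an algebra isomorphism $$A[t_1;\sigma_1,\delta_1]\cdots[t_n;\sigma_n,\delta_n]\;\cong\;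 A'[t'_1;\sigma'_1,\delta'_1]\cdots[t'_n;\sigma'_n,\delta'_n]$$ between iterated Ore extensions in which all $\sigma_i$ and all $\sigma'_i$ are locally algebraic implies $A\cong A'$ as algebras. It is *strongly $\delta$-cancellative* if the same holds for iterated Ore extensions in which all $\sigma_i$ and all $\sigma'_i$ are identity maps. The Gelfand–Kirillov dimension of $A$ is $\operatorname{GKdim}A=\sup_V\limsup_{n\to\infty}\log_n(\dim_\Bbbk V^n)$, where $V$ runs over the finite dimensional subspaces of $A$. For a domain $A$ and a subset $F\subseteq A$, let $Sw(F)$ be the set of all $g\in A$ such that $f=agb$ for some $a,b\in A$ and some $0\ne f\in F$. Put $D_0(F)=F$, let $D_n(F)$ for $n\ge 1$ be the $\Bbbk$-subalgebra of $A$ generated by $Sw(D_{n-1}(F))$, and let $\mathbb D(F)=\bigcup_{n\ge 0}D_n(F)$, the divisor subalgebra of $A$ generated by $F$; write $\mathbb D(f)$ for $\mathbb D(\{f\})$. **Theorem.** Let $A$ be a domain that is finitely generated as a $\Bbbk$-algebra and has finite Gelfand–Kirillov dimension. Suppose that $\mathbb D(1)=A$. Then $A$ is strongly $\sigma$-algebraically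 cancellative. As a consequence, $A$ is strongly $\delta$-cancellative. -/

import Mathlib

open Filter

/-- An algebra automorphism `σ` of `A` is locally algebraic
if every finite dimensional subspace of `A` is contained in a `σ`-stable finite dimensional
subspace. -/
def IsLocallyAlgebraic {k A : Type*} [Field k] [Ring A] [Algebra k A] (σ : A ≃ₐ[k] A) : Prop :=
  ∀ V : Submodule k A, FiniteDimensional k V →
    ∃ W : Submodule k A, V ≤ W ∧ FiniteDimensional k W ∧ ∀ w ∈ W, σ w ∈ W

/-- `δ` is a (`k`-linear, left) `σ`-derivation of `A`. -/
def IsSkewDerivation {k A : Type*} [Field k] [Ring A] [Algebra k A]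
    (σ : A ≃ₐ[k] A) (δ : A →ₗ[k] A) : Prop :=
  ∀ a b : A, δ (a * b) = σ a * δ b + δ a * b

/-- The algebra `S`, with the structure map `ι : R → S` and the element `t : S`, is the Ore
extension `R[t; σ, δ]`: `δ` is a `σ`-derivation of `R`, the relation `t r = σ(r) t + δ(r)` holds,
and `S` is a free left `R`-module with basis `1, t, t², …` (every element of `S` is uniquely of the
form `∑ rᵢ tⁱ`; in particular `ι` is injective). -/
structure IsOreExtension {k R S : Type*} [Field k] [Ring R] [Algebra k R] [Ring S] [Algebra k S]
    (ι : R →ₐ[k] S) (t : S) (σ : R ≃ₐ[k] R) (δ : R →ₗ[k] R) : Prop where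
  skewDerivation : IsSkewDerivation σ δ
  mul_eq : ∀ r : R, t * ι r = ι (σ r) * t + ι (δ r)
  bijective : Function.Bijective (fun p : ℕ →₀ R => p.sum fun i r => ι r * t ^ i)

/-- The structure of an iterated Ore extension
`A[t₁; σ₁, δ₁][t₂; σ₂, δ₂] ⋯ [tₙ; σₙ, δₙ]` on the algebra `Y`: an embedding `ι` of `A` in `Y`, and
a chain of subalgebras `ι(A) = A₀ ⊆ A₁ ⊆ ⋯ ⊆ Aₙ = Y` in which each member is an Ore extension
`Aᵢ₊₁ = Aᵢ[t; σ, δ]` of the previous one, for an automorphism `σ` of the algebra `Aᵢ` and a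
`σ`-derivation `δ` of `Aᵢ`. -/
structure IteratedOreExtension (k A Y : Type*) [Field k] [Ring A] [Algebra k A]
    [Ring Y] [Algebra k Y] (n : ℕ) where
  ι : A →ₐ[k] Y
  ι_injective : Function.Injective ι
  chain : Fin (n + 1) → Subalgebra k Y
  chain_zero : chain 0 = ι.range
  chain_last : chain (Fin.last n) = ⊤
  chain_le : ∀ i : Fin n, chain i.castSucc ≤ chain i.succ
  t : ∀ i : Fin n, chain i.succ
  σ : ∀ i : Fin n, chain i.castSucc ≃ₐ[k] chain i.castSucc
  δ : ∀ i : Fin n, chain i.castSucc →ₗ[k] chain i.castSucc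
  isOre : ∀ i : Fin n, IsOreExtension (Subalgebra.inclusion (chain_le i)) (t i) (σ i) (δ i)

universe uk uA uA' uY uY'

/-- `A` is strongly `σ`-algebraically cancellative: for every `n ≥ 1` and every algebra `A'`, if
some `n`-step iterated Ore extensions `Y` of `A` and `Y'` of `A'`, all of whose automorphisms are
locally algebraic, are isomorphic, then `A ≅ A'`. -/
def IsStronglySigmaAlgebraicallyCancellative (k : Type uk) (A : Type uA)
    [Field k] [Ring A] [Algebra k A] : Prop :=
  ∀ (n : ℕ), 1 ≤ n → ∀ (A' : Type uA') [Ring A'] [Algebra k A']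
    (Y : Type uY) [Ring Y] [Algebra k Y] (Y' : Type uY') [Ring Y'] [Algebra k Y']
    (E : IteratedOreExtension k A Y n) (E' : IteratedOreExtension k A' Y' n),
    (∀ i, IsLocallyAlgebraic (E.σ i)) → (∀ i, IsLocallyAlgebraic (E'.σ i)) →
    Nonempty (Y ≃ₐ[k] Y') → Nonempty (A ≃ₐ[k] A')

/-- `A` is strongly `δ`-cancellative: for every `n ≥ 1` and every algebra `A'`, if some `n`-step
iterated Ore extensions `Y` of `A` and `Y'` of `A'`, all of whose automorphisms are identity maps,
are isomorphic, then `A ≅ A'`. -/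
def IsStronglyDeltaCancellative (k : Type uk) (A : Type uA)
    [Field k] [Ring A] [Algebra k A] : Prop :=
  ∀ (n : ℕ), 1 ≤ n → ∀ (A' : Type uA') [Ring A'] [Algebra k A']
    (Y : Type uY) [Ring Y] [Algebra k Y] (Y' : Type uY') [Ring Y'] [Algebra k Y']
    (E : IteratedOreExtension k A Y n) (E' : IteratedOreExtension k A' Y' n),
    (∀ i, E.σ i = AlgEquiv.refl) → (∀ i, E'.σ i = AlgEquiv.refl) →
    Nonempty (Y ≃ₐ[k] Y') → Nonempty (A ≃ₐ[k] A')

/-- The Gelfand–Kirillov dimension `sup_V limsup_n log_n (dim V^n)`, where `V` runs over the finite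
dimensional subspaces of `A`, as an extended real number. -/
noncomputable def GKdim (k A : Type*) [Field k] [Ring A] [Algebra k A] : EReal :=
  ⨆ V : {V : Submodule k A // FiniteDimensional k V},
    limsup (fun n : ℕ =>
      ((Real.logb (n : ℝ) (Module.finrank k ↥(V.1 ^ n) : ℝ) : ℝ) : EReal)) atTop

/-- The set of subwords of the nonzero elements of `F`. -/
def subwords {A : Type*} [Ring A] (F : Set A) : Set A :=
  {g | ∃ f ∈ F, f ≠ 0 ∧ ∃ a b : A, f = a * g * b}

/-- `D₀(F) = F`, and `Dₙ₊₁(F)` is the subalgebra generated by the subwords of `Dₙ(F)`. -/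
def divisorStep (k : Type*) {A : Type*} [Field k] [Ring A] [Algebra k A] (F : Set A) : ℕ → Set A
  | 0 => F
  | n + 1 => (Algebra.adjoin k (subwords (divisorStep k F n)) : Set A)

theorem divisorStep_subset_succ (k : Type*) {A : Type*} [Field k] [Ring A] [Algebra k A]
    (F : Set A) (n : ℕ) : divisorStep k F n ⊆ divisorStep k F (n + 1) := by
  intro x hx
  change x ∈ Algebra.adjoin k (subwords (divisorStep k F n))
  by_cases h : x = 0
  · rw [h]
    exact zero_mem _
  · exact Algebra.subset_adjoin ⟨x, hx, h, 1, 1, by simp⟩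

theorem divisorStep_mono (k : Type*) {A : Type*} [Field k] [Ring A] [Algebra k A]
    (F : Set A) : Monotone (divisorStep k F) :=
  monotone_nat_of_le_succ (divisorStep_subset_succ k F)

/-- The divisor subalgebra `𝔻(F) = ⋃ₙ Dₙ(F)` of `A` generated by `F`. -/
def divisorSubalgebra (k : Type*) {A : Type*} [Field k] [Ring A] [Algebra k A] (F : Set A) :
    Subalgebra k A where
  carrier := ⋃ n, divisorStep k F n
  algebraMap_mem' r := Set.mem_iUnion.2
    ⟨1, (Algebra.adjoin k (subwords (divisorStep k F 0))).algebraMap_mem r⟩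
  add_mem' := by
    intro a b ha hb
    obtain ⟨m, hm⟩ := Set.mem_iUnion.1 ha
    obtain ⟨n, hn⟩ := Set.mem_iUnion.1 hb
    exact Set.mem_iUnion.2 ⟨max m n + 1,
      (Algebra.adjoin k (subwords (divisorStep k F (max m n)))).add_mem
        (divisorStep_mono k F ((le_max_left m n).trans (Nat.le_succ _)) hm)
        (divisorStep_mono k F ((le_max_right m n).trans (Nat.le_succ _)) hn)⟩
  mul_mem' := by
    intro a b ha hb
    obtain ⟨m, hm⟩ := Set.mem_iUnion.1 ha
    obtain ⟨n, hn⟩ := Set.mem_iUnion.1 hb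
    exact Set.mem_iUnion.2 ⟨max m n + 1,
      (Algebra.adjoin k (subwords (divisorStep k F (max m n)))).mul_mem
        (divisorStep_mono k F ((le_max_left m n).trans (Nat.le_succ _)) hm)
        (divisorStep_mono k F ((le_max_right m n).trans (Nat.le_succ _)) hn)⟩

/-! Identify `Y` with `Y'`, so that `A` and `A'` lie in one algebra. It is a domain because `A` is,
hence so is `A'`. Over a domain degrees in `t` add under multiplication, so the base of an iterated
Ore extension contains every factor of each of its nonzero elements (`factors_mem_range`). Since `A`
is built from `1` by repeatedly taking factors and generating subalgebras, `A ⊆ A'`.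

Growth gives equality. Suppose `f ∈ A'` lies outside `A`. The powers of `f` are left independent
over `A` (`eq_zero_of_sum_pow_eq_zero`), so a bound `O(N ^ d)` for `A'` yields `O(N ^ (d - 1))` for
`A`. Each Ore step with locally algebraic automorphism raises the exponent by at most one
(`IsOreExtension.hasGrowthBound`), and passing back to the coefficient ring lowers it by one
(`of_independent_powers`). So a bound for `A` climbs `n` steps to `Y`, descends `n` steps to `A'`,
and then drops once more on `A`. Starting from a bound that cannot be lowered by one is a
contradiction. -/

/-! ### Degrees and leading coefficients in an Ore extension -/

namespace IsOreExtension

variable {k R S : Type*} [Field k] [Ring R] [Algebra k R] [Ring S] [Algebra k S]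
  {ι : R →ₐ[k] S} {t : S} {σ : R ≃ₐ[k] R} {δ : R →ₗ[k] R}

/-- The coefficients of an element of an Ore extension. -/
noncomputable def coeffEquiv (h : IsOreExtension ι t σ δ) : (ℕ →₀ R) ≃+ S :=
  { Equiv.ofBijective _ h.bijective with
    map_add' := fun p q => by
      change (p + q).sum (fun i r => ι r * t ^ i) =
        p.sum (fun i r => ι r * t ^ i) + q.sum (fun i r => ι r * t ^ i)
      exact Finsupp.sum_add_index' (by simp) (by simp [add_mul]) }

/-- The coefficient of `t ^ i`. -/
noncomputable def coeff (h : IsOreExtension ι t σ δ) (i : ℕ) : S →+ R :=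
  (Finsupp.applyAddHom i).comp h.coeffEquiv.symm.toAddMonoidHom

theorem coeff_monomial (h : IsOreExtension ι t σ δ) (i j : ℕ) (r : R) :
    h.coeff i (ι r * t ^ j) = if j = i then r else 0 := by
  have : h.coeffEquiv.symm (ι r * t ^ j) = Finsupp.single j r := by
    rw [AddEquiv.symm_apply_eq]
    change _ = (Finsupp.single j r).sum (fun i r => ι r * t ^ i)
    simp
  change h.coeffEquiv.symm (ι r * t ^ j) i = _
  rw [this, Finsupp.single_apply]

/-- The elements of degree less than `n` in `t`. -/
def degreeLT (h : IsOreExtension ι t σ δ) (n : ℕ) : AddSubgroup S where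
  carrier := {s | ∀ i, n ≤ i → h.coeff i s = 0}
  zero_mem' := by simp
  add_mem' := fun ha hb i hi => by rw [map_add, ha i hi, hb i hi, add_zero]
  neg_mem' := fun ha i hi => by rw [map_neg, ha i hi, neg_zero]

theorem degreeLT_mono (h : IsOreExtension ι t σ δ) {m n : ℕ} (hmn : m ≤ n) {x : S}
    (hx : x ∈ h.degreeLT m) : x ∈ h.degreeLT n :=
  fun i hi => hx i (hmn.trans hi)

theorem monomial_mem_degreeLT (h : IsOreExtension ι t σ δ) (r : R) {i n : ℕ} (hi : i < n) :
    ι r * t ^ i ∈ h.degreeLT n := by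
  intro j hj
  rw [h.coeff_monomial, if_neg (by omega)]

theorem eq_sum_of_mem_degreeLT (h : IsOreExtension ι t σ δ) {n : ℕ} {x : S}
    (hx : x ∈ h.degreeLT n) :
    x = ∑ i ∈ Finset.range n, ι (h.coeff i x) * t ^ i := by
  conv_lhs => rw [← h.coeffEquiv.apply_symm_apply x]
  change (h.coeffEquiv.symm x).sum (fun i r => ι r * t ^ i) = _
  refine Finsupp.sum_of_support_subset _ (fun i hi => ?_) _ (by simp)
  by_contra hn
  exact (Finsupp.mem_support_iff.1 hi) (hx i (by simpa using hn))

theorem map_mul_mem_degreeLT (h : IsOreExtension ι t σ δ) {n : ℕ} (r : R) {x : S}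
    (hx : x ∈ h.degreeLT n) : ι r * x ∈ h.degreeLT n := by
  rw [h.eq_sum_of_mem_degreeLT hx, Finset.mul_sum]
  refine sum_mem fun i hi => ?_
  rw [← mul_assoc, ← map_mul]
  exact h.monomial_mem_degreeLT _ (Finset.mem_range.1 hi)

theorem mul_pow_mem_degreeLT (h : IsOreExtension ι t σ δ) {n : ℕ} (m : ℕ) {x : S}
    (hx : x ∈ h.degreeLT n) : x * t ^ m ∈ h.degreeLT (n + m) := by
  rw [h.eq_sum_of_mem_degreeLT hx, Finset.sum_mul]
  refine sum_mem fun i hi => ?_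
  rw [mul_assoc, ← pow_add]
  exact h.monomial_mem_degreeLT _ (by have := Finset.mem_range.1 hi; omega)

theorem mul_mem_degreeLT_succ (h : IsOreExtension ι t σ δ) {n : ℕ} {x : S}
    (hx : x ∈ h.degreeLT n) : t * x ∈ h.degreeLT (n + 1) := by
  rw [h.eq_sum_of_mem_degreeLT hx, Finset.mul_sum]
  refine sum_mem fun i hi => ?_
  have hi := Finset.mem_range.1 hi
  rw [← mul_assoc, h.mul_eq, add_mul, mul_assoc, ← pow_succ']
  exact add_mem (h.monomial_mem_degreeLT _ (by omega)) (h.monomial_mem_degreeLT _ (by omega))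

theorem pow_mul_mem_degreeLT (h : IsOreExtension ι t σ δ) {n : ℕ} (m : ℕ) {x : S}
    (hx : x ∈ h.degreeLT n) : t ^ m * x ∈ h.degreeLT (n + m) := by
  induction m with
  | zero => simpa using hx
  | succ m ih =>
    rw [pow_succ', mul_assoc]
    exact h.mul_mem_degreeLT_succ ih

/-- The bounds are asymmetric, degree `< n` against degree `≤ m`, so that lower order terms of the
left factor can be discarded in `coeff_mul`. -/
theorem mul_mem_degreeLT (h : IsOreExtension ι t σ δ) {n m : ℕ} {x y : S}
    (hx : x ∈ h.degreeLT n) (hy : y ∈ h.degreeLT (m + 1)) : x * y ∈ h.degreeLT (n + m) := by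
  rw [h.eq_sum_of_mem_degreeLT hx, Finset.sum_mul]
  refine sum_mem fun i hi => ?_
  have hi := Finset.mem_range.1 hi
  rw [mul_assoc]
  exact h.map_mul_mem_degreeLT _ (h.degreeLT_mono (by omega) (h.pow_mul_mem_degreeLT i hy))

theorem pow_mul_map_sub_mem_degreeLT (h : IsOreExtension ι t σ δ) (n : ℕ) (r : R) :
    t ^ n * ι r - ι ((σ : R → R)^[n] r) * t ^ n ∈ h.degreeLT n := by
  induction n with
  | zero => simp
  | succ n ih =>
    have h1 := h.mul_mem_degreeLT_succ ih
    have h2 : ι (δ ((σ : R → R)^[n] r)) * t ^ n ∈ h.degreeLT (n + 1) :=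
      h.monomial_mem_degreeLT _ (by omega)
    convert add_mem h1 h2 using 1
    rw [mul_sub, ← mul_assoc t (ι _), h.mul_eq, Function.iterate_succ_apply', pow_succ' t n]
    noncomm_ring

/-- Subtracting the leading term lowers the degree. -/
theorem sub_leading_mem_degreeLT (h : IsOreExtension ι t σ δ) {n : ℕ} {x : S}
    (hx : x ∈ h.degreeLT (n + 1)) : x - ι (h.coeff n x) * t ^ n ∈ h.degreeLT n := by
  intro i hi
  rw [map_sub, h.coeff_monomial]
  split_ifs with hni
  · rw [hni, sub_self]
  · rw [hx i (by omega), sub_zero]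

/-- Replace `x` by its leading term, then `y` by its leading term, then move `t ^ n` past the
coefficient of `y`. Each replacement (`h1`, `h2`, `h3`) costs only terms of degree below `n + m`. -/
theorem coeff_mul (h : IsOreExtension ι t σ δ) {n m : ℕ} {x y : S}
    (hx : x ∈ h.degreeLT (n + 1)) (hy : y ∈ h.degreeLT (m + 1)) :
    h.coeff (n + m) (x * y) = h.coeff n x * (σ : R → R)^[n] (h.coeff m y) := by
  set a := h.coeff n x
  set b := h.coeff m y
  have h1 : (x - ι a * t ^ n) * y ∈ h.degreeLT (n + m) :=
    h.mul_mem_degreeLT (h.sub_leading_mem_degreeLT hx) hy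
  have h2 : ι a * (t ^ n * (y - ι b * t ^ m)) ∈ h.degreeLT (n + m) :=
    h.map_mul_mem_degreeLT _ (h.degreeLT_mono (by omega)
      (h.pow_mul_mem_degreeLT n (h.sub_leading_mem_degreeLT hy)))
  have h3 : ι a * ((t ^ n * ι b - ι ((σ : R → R)^[n] b) * t ^ n) * t ^ m) ∈ h.degreeLT (n + m) :=
    h.map_mul_mem_degreeLT _ (h.mul_pow_mem_degreeLT m (h.pow_mul_map_sub_mem_degreeLT n b))
  have h4 := add_mem (add_mem h1 h2) h3 (n + m) le_rfl
  have h5 : (x - ι a * t ^ n) * y + ι a * (t ^ n * (y - ι b * t ^ m)) +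
      ι a * ((t ^ n * ι b - ι ((σ : R → R)^[n] b) * t ^ n) * t ^ m) =
      x * y - ι (a * (σ : R → R)^[n] b) * t ^ (n + m) := by
    rw [map_mul, pow_add]
    noncomm_ring
  rw [h5, map_sub, h.coeff_monomial, if_pos rfl, sub_eq_zero] at h4
  exact h4

theorem exists_leading (h : IsOreExtension ι t σ δ) {x : S} (hx : x ≠ 0) :
    ∃ n, x ∈ h.degreeLT (n + 1) ∧ h.coeff n x ≠ 0 := by
  have hne : (h.coeffEquiv.symm x).support.Nonempty := by
    rw [Finsupp.support_nonempty_iff]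
    simpa using hx
  refine ⟨(h.coeffEquiv.symm x).support.max' hne, fun i hi => ?_,
    Finsupp.mem_support_iff.1 (Finset.max'_mem _ hne)⟩
  by_contra hn
  have := Finset.le_max' (h.coeffEquiv.symm x).support i (Finsupp.mem_support_iff.2 hn)
  exact (Nat.lt_of_succ_le hi).not_ge this

theorem coeff_mul_ne_zero [NoZeroDivisors R] (h : IsOreExtension ι t σ δ) {n m : ℕ} {x y : S}
    (hx : x ∈ h.degreeLT (n + 1)) (hy : y ∈ h.degreeLT (m + 1))
    (hx0 : h.coeff n x ≠ 0) (hy0 : h.coeff m y ≠ 0) : h.coeff (n + m) (x * y) ≠ 0 := by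
  rw [h.coeff_mul hx hy]
  refine mul_ne_zero hx0 fun h0 => hy0 ?_
  refine (σ.injective.iterate n) ?_
  rw [h0]
  exact (Function.iterate_fixed (map_zero σ) n).symm

theorem noZeroDivisors [NoZeroDivisors R] (h : IsOreExtension ι t σ δ) : NoZeroDivisors S where
  eq_zero_or_eq_zero_of_mul_eq_zero := by
    intro x y hxy
    by_contra! hne
    obtain ⟨n, hx, hx0⟩ := h.exists_leading hne.1
    obtain ⟨m, hy, hy0⟩ := h.exists_leading hne.2
    exact h.coeff_mul_ne_zero hx hy hx0 hy0 (by rw [hxy, map_zero])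

theorem mem_range_of_mem_degreeLT_one (h : IsOreExtension ι t σ δ) {x : S}
    (hx : x ∈ h.degreeLT 1) : x ∈ ι.range :=
  ⟨h.coeff 0 x, by simpa using (h.eq_sum_of_mem_degreeLT hx).symm⟩

/-- The coefficient ring of an Ore extension of a domain is closed under taking factors. -/
theorem factors_mem_range [NoZeroDivisors R] (h : IsOreExtension ι t σ δ) {x y : S}
    (hxy : x * y ∈ ι.range) (hne : x * y ≠ 0) : x ∈ ι.range ∧ y ∈ ι.range := by
  obtain ⟨n, hx, hx0⟩ := h.exists_leading (left_ne_zero_of_mul hne)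
  obtain ⟨m, hy, hy0⟩ := h.exists_leading (right_ne_zero_of_mul hne)
  have h1 := h.coeff_mul_ne_zero hx hy hx0 hy0
  obtain ⟨r, hr⟩ := hxy
  have h2 : x * y = ι r * t ^ 0 := by rw [pow_zero, mul_one]; exact hr.symm
  rw [h2, h.coeff_monomial] at h1
  -- The product is a constant, yet its coefficient at `n + m` is nonzero.
  have h3 : 0 = n + m := by
    by_contra hc
    exact h1 (if_neg hc)
  obtain rfl : n = 0 := by omega
  obtain rfl : m = 0 := by omega
  exact ⟨h.mem_range_of_mem_degreeLT_one hx, h.mem_range_of_mem_degreeLT_one hy⟩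

/-- Powers of an element outside the coefficient ring are left independent over it. -/
theorem eq_zero_of_sum_pow_eq_zero [IsDomain R] (h : IsOreExtension ι t σ δ) {f : S}
    (hf : f ∉ ι.range) (c : ℕ → R) (N : ℕ)
    (hc : ∑ i ∈ Finset.range N, ι (c i) * f ^ i = 0) : ∀ i < N, c i = 0 := by
  have hf0 : f ≠ 0 := fun h0 => hf (h0 ▸ zero_mem _)
  obtain ⟨n, hn, hn0⟩ := h.exists_leading hf0
  have hn1 : n ≠ 0 := by
    rintro rfl
    exact hf (h.mem_range_of_mem_degreeLT_one hn)
  have hconst (r : R) : ι r ∈ h.degreeLT (0 + 1) ∧ h.coeff 0 (ι r) = r := by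
    have h1 := h.monomial_mem_degreeLT r (zero_lt_one' ℕ)
    have h2 := h.coeff_monomial 0 0 r
    rw [pow_zero, mul_one] at h1 h2
    exact ⟨h1, h2.trans (if_pos rfl)⟩
  -- The degree of `f ^ j` is exactly `j * n` with `n > 0`, so terms with distinct exponents cannot
  -- cancel at the top.
  have hpow (j : ℕ) : f ^ j ∈ h.degreeLT (j * n + 1) ∧ h.coeff (j * n) (f ^ j) ≠ 0 := by
    induction j with
    | zero =>
      have := hconst 1
      rw [map_one] at this
      simpa [this.2] using this.1
    | succ j ih =>
      rw [pow_succ, Nat.succ_mul]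
      refine ⟨?_, h.coeff_mul_ne_zero ih.1 hn ih.2 hn0⟩
      have := h.mul_mem_degreeLT ih.1 hn
      rwa [Nat.add_right_comm] at this
  induction N with
  | zero => intro i hi; omega
  | succ N ih =>
    rw [Finset.sum_range_succ] at hc
    have hlast : c N = 0 := by
      by_contra hcN
      have h1 := h.coeff_mul_ne_zero (hconst (c N)).1 (hpow N).1
        (by rwa [(hconst (c N)).2]) (hpow N).2
      have h2 : ∑ i ∈ Finset.range N, ι (c i) * f ^ i ∈ h.degreeLT (0 + N * n) := by
        refine sum_mem fun i hi => h.degreeLT_mono ?_ (h.map_mul_mem_degreeLT _ (hpow i).1)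
        have h3 := Nat.mul_le_mul_right n (Nat.succ_le_of_lt (Finset.mem_range.1 hi))
        rw [Nat.succ_mul] at h3
        omega
      have h3 := congrArg (h.coeff (0 + N * n)) hc
      rw [map_add, h2 _ le_rfl, zero_add, map_zero] at h3
      exact h1 h3
    rw [hlast, map_zero, zero_mul, add_zero] at hc
    intro i hi
    rcases Nat.lt_succ_iff_lt_or_eq.1 hi with h1 | rfl
    · exact ih hc i h1
    · exact hlast

theorem eq_zero_of_sum_eq_zero (h : IsOreExtension ι t σ δ) (c : ℕ → R) (N : ℕ)
    (hc : ∑ i ∈ Finset.range N, ι (c i) * t ^ i = 0) : ∀ i < N, c i = 0 := by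
  intro j hj
  have h1 := congrArg (h.coeff j) hc
  rw [map_sum, map_zero] at h1
  simpa [h.coeff_monomial, hj] using h1

end IsOreExtension

/-! ### Powers of finite dimensional subspaces -/

/-- Every finite dimensional subspace `V` of `R` satisfies `dim V ^ n = O(n ^ d)`. -/
def HasGrowthBound (k R : Type*) [Field k] [Ring R] [Algebra k R] (d : ℝ) : Prop :=
  ∀ V : Submodule k R, FiniteDimensional k V →
    ∃ C : ℝ, ∀ n : ℕ, 1 ≤ n → (Module.finrank k ↥(V ^ n) : ℝ) ≤ C * (n : ℝ) ^ d

section Subspaces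

variable {k R S : Type*} [Field k] [Ring R] [Algebra k R] [Ring S] [Algebra k S]

theorem Submodule.finiteDimensional_pow (V : Submodule k R) [FiniteDimensional k V] (n : ℕ) :
    FiniteDimensional k ↥(V ^ n) :=
  Module.Finite.iff_fg.2 ((Module.Finite.iff_fg.1 ‹_›).pow n)

theorem Submodule.finiteDimensional_mul (V W : Submodule k R) [FiniteDimensional k V]
    [FiniteDimensional k W] : FiniteDimensional k ↥(V * W) :=
  Module.Finite.iff_fg.2 ((Module.Finite.iff_fg.1 ‹_›).mul (Module.Finite.iff_fg.1 ‹_›))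

theorem Submodule.finrank_mul_le (V W : Submodule k R) [FiniteDimensional k V]
    [FiniteDimensional k W] :
    Module.finrank k ↥(V * W) ≤ Module.finrank k V * Module.finrank k W := by
  rw [← Submodule.mulMap_range, ← Module.finrank_tensorProduct]
  exact LinearMap.finrank_range_le _

/-- The powers of a generating subspace containing `1` absorb every finite dimensional subspace. -/
theorem Submodule.exists_le_pow_of_adjoin_eq_top {V : Submodule k R} (h1 : 1 ≤ V)
    (hV : Algebra.adjoin k (V : Set R) = ⊤) (U : Submodule k R) [FiniteDimensional k U] :
    ∃ m, U ≤ V ^ m := by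
  have hx (x : R) : ∃ m, x ∈ V ^ m := by
    have hx : x ∈ Algebra.adjoin k (V : Set R) := hV ▸ Algebra.mem_top
    induction hx using Algebra.adjoin_induction with
    | mem x hx => exact ⟨1, by simpa using hx⟩
    | algebraMap r => exact ⟨0, by rw [pow_zero]; exact Submodule.algebraMap_mem r⟩
    | add x y _ _ hx hy =>
      obtain ⟨a, ha⟩ := hx
      obtain ⟨b, hb⟩ := hy
      exact ⟨max a b, add_mem (pow_le_pow_right₀ h1 (le_max_left a b) ha)
        (pow_le_pow_right₀ h1 (le_max_right a b) hb)⟩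
    | mul x y _ _ hx hy =>
      obtain ⟨a, ha⟩ := hx
      obtain ⟨b, hb⟩ := hy
      exact ⟨a + b, by rw [pow_add]; exact Submodule.mul_mem_mul ha hb⟩
  choose m hm using hx
  obtain ⟨s, rfl⟩ := Module.Finite.iff_fg.1 ‹FiniteDimensional k U›
  exact ⟨s.sup m, Submodule.span_le.2 fun x hx =>
    pow_le_pow_right₀ h1 (Finset.le_sup (f := m) hx) (hm x)⟩

theorem Submodule.span_one_pair_pow_le (t : R) (n : ℕ) :
    Submodule.span k {1, t} ^ n ≤
      Submodule.span k (Set.range fun i : Fin (n + 1) => t ^ (i : ℕ)) := by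
  induction n with
  | zero =>
    rw [pow_zero, Submodule.one_eq_span, Submodule.span_le]
    rintro _ rfl
    exact Submodule.subset_span ⟨0, by simp⟩
  | succ n ih =>
    rw [pow_succ]
    refine (mul_le_mul_left ih _).trans ?_
    rw [Submodule.span_mul_span, Submodule.span_le]
    rintro _ ⟨_, ⟨i, rfl⟩, y, rfl | rfl, rfl⟩
    · exact Submodule.subset_span ⟨i.castSucc, by simp⟩
    · exact Submodule.subset_span ⟨i.succ, by simp [pow_succ]⟩

theorem Submodule.finrank_span_one_pair_pow_le (t : R) (n : ℕ) :
    Module.finrank k ↥(Submodule.span k {1, t} ^ n) ≤ n + 1 := by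
  have : FiniteDimensional k
      (Submodule.span k (Set.range fun i : Fin (n + 1) => t ^ (i : ℕ))) :=
    FiniteDimensional.span_of_finite k (Set.finite_range _)
  refine (Submodule.finrank_mono (Submodule.span_one_pair_pow_le t n)).trans ?_
  refine (finrank_range_le_card _).trans ?_
  simp

end Subspaces

/-! ### Polynomial growth bounds -/

namespace HasGrowthBound

variable {k R S : Type*} [Field k] [Ring R] [Algebra k R] [Ring S] [Algebra k S] {d : ℝ}

theorem of_injective (φ : R →ₐ[k] S) (hφ : Function.Injective φ) (h : HasGrowthBound k S d) :
    HasGrowthBound k R d := by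
  intro V hV
  obtain ⟨C, hC⟩ := h (V.map φ.toLinearMap) inferInstance
  refine ⟨C, fun n hn => ?_⟩
  have := hC n hn
  rw [← Submodule.map_pow] at this
  rwa [(Submodule.equivMapOfInjective φ.toLinearMap hφ (V ^ n)).finrank_eq]

/-- Adjoining an element whose powers are left independent raises the growth by at least one. -/
theorem of_independent_powers (ι : R →ₐ[k] S) (f : S)
    (hf : ∀ (c : ℕ → R) (N : ℕ), ∑ i ∈ Finset.range N, ι (c i) * f ^ i = 0 → ∀ i < N, c i = 0)
    (h : HasGrowthBound k S (d + 1)) : HasGrowthBound k R d := by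
  intro V hV
  set W := V.map ι.toLinearMap ⊔ Submodule.span k {1, f}
  have hfin : FiniteDimensional k (Submodule.span k {1, f}) :=
    FiniteDimensional.span_of_finite k (by simp)
  have hWfin : FiniteDimensional k W := Submodule.finiteDimensional_sup _ _
  obtain ⟨C, hC⟩ := h W hWfin
  refine ⟨C * 2 ^ (d + 1), fun N hN => ?_⟩
  have hW1 : 1 ≤ W := Submodule.one_le.2
    (Submodule.mem_sup_right (Submodule.subset_span (by simp)))
  have hWf : f ∈ W := Submodule.mem_sup_right (Submodule.subset_span (by simp))
  have hmem (i : Fin (N + 1)) (v : ↥(V ^ N)) : ι v * f ^ (i : ℕ) ∈ W ^ (2 * N) := by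
    rw [two_mul, pow_add]
    refine Submodule.mul_mem_mul ?_ ?_
    · have h1 : V.map ι.toLinearMap ^ N ≤ W ^ N := pow_le_pow_left' le_sup_left N
      rw [← Submodule.map_pow] at h1
      exact h1 (Submodule.mem_map_of_mem v.2)
    · exact pow_le_pow_right₀ hW1 (Nat.lt_succ_iff.1 i.2) (Submodule.pow_mem_pow _ hWf _)
  have : FiniteDimensional k ↥(W ^ (2 * N)) := Submodule.finiteDimensional_pow _ _
  have : FiniteDimensional k ↥(V ^ N) := Submodule.finiteDimensional_pow _ _
  -- By independence, `N + 1` copies of `V ^ N`, one for each power of `f` up to `N`, embed in `W ^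
  -- (2 * N)`. Dividing the bound for the latter by `N` lowers the exponent by one.
  let L : (Fin (N + 1) → ↥(V ^ N)) →ₗ[k] ↥(W ^ (2 * N)) :=
    { toFun := fun c => ⟨∑ i, ι (c i) * f ^ (i : ℕ), sum_mem fun i _ => hmem i (c i)⟩
      map_add' := fun c c' => by
        ext
        simp [add_mul, Finset.sum_add_distrib]
      map_smul' := fun a c => by
        ext
        simp [Finset.smul_sum] }
  have hL : Function.Injective L := by
    rw [injective_iff_map_eq_zero]
    intro c hc
    have h0 : ∑ i : Fin (N + 1), ι (c i) * f ^ (i : ℕ) = 0 := congrArg Subtype.val hc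
    let c' : ℕ → R := fun i => if hi : i < N + 1 then (c ⟨i, hi⟩ : R) else 0
    have h1 : ∑ i ∈ Finset.range (N + 1), ι (c' i) * f ^ i = 0 := by
      rw [Finset.sum_range, ← h0]
      refine Finset.sum_congr rfl fun i _ => ?_
      simp only [c', i.2, dif_pos]
    ext i
    have h2 := hf c' (N + 1) h1 i i.2
    simp only [c', i.2, dif_pos] at h2
    exact h2
  have hrank := LinearMap.finrank_le_finrank_of_injective hL
  rw [Module.finrank_pi_fintype, Finset.sum_const, Finset.card_univ, Fintype.card_fin,
    smul_eq_mul] at hrank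
  have hN0 : (0 : ℝ) < N := by exact_mod_cast hN
  have h3 : (N : ℝ) * Module.finrank k ↥(V ^ N) ≤ C * 2 ^ (d + 1) * (N : ℝ) ^ d * N := by
    calc (N : ℝ) * Module.finrank k ↥(V ^ N) ≤ ((N + 1) * Module.finrank k ↥(V ^ N) : ℕ) := by
          push_cast
          gcongr
          linarith
      _ ≤ Module.finrank k ↥(W ^ (2 * N)) := by exact_mod_cast hrank
      _ ≤ C * ((2 * N : ℕ) : ℝ) ^ (d + 1) := hC _ (by omega)
      _ = C * 2 ^ (d + 1) * (N : ℝ) ^ d * N := by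
          push_cast
          rw [Real.mul_rpow (by norm_num) hN0.le, Real.rpow_add_one hN0.ne']
          ring
  rw [mul_comm] at h3
  exact le_of_mul_le_mul_right h3 hN0

/-- A nontrivial algebra has no negative growth bound. -/
theorem nonneg [Nontrivial R] (h : HasGrowthBound k R d) : 0 ≤ d := by
  by_contra! hd
  have hfin : FiniteDimensional k (1 : Submodule k R) := by
    rw [Submodule.one_eq_span]
    infer_instance
  -- The line of scalars has all its powers of dimension one, while `C * n ^ d` tends to `0` for `d
  -- < 0`.
  obtain ⟨C, hC⟩ := h 1 hfin
  have hrank : Module.finrank k (1 : Submodule k R) = 1 := by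
    rw [Submodule.one_eq_span]
    exact finrank_span_singleton one_ne_zero
  have hlim : Tendsto (fun n : ℕ => C * (n : ℝ) ^ d) atTop (nhds (C * 0)) := by
    have := (tendsto_rpow_neg_atTop (neg_pos.2 hd)).comp (tendsto_natCast_atTop_atTop (R := ℝ))
    simpa using this.const_mul C
  have h1 : (1 : ℝ) ≤ C * 0 := by
    refine ge_of_tendsto hlim ((eventually_ge_atTop 1).mono fun n hn => ?_)
    have := hC n hn
    rwa [one_pow, hrank, Nat.cast_one] at this
  norm_num at h1

/-- A growth bound that cannot be improved by one. -/
theorem exists_sharp [Nontrivial R] (h : HasGrowthBound k R d) :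
    ∃ e, HasGrowthBound k R e ∧ ¬ HasGrowthBound k R (e - 1) := by
  by_contra! hcon
  have hall (n : ℕ) : HasGrowthBound k R (d - n) := by
    induction n with
    | zero => simpa using h
    | succ n ih =>
      have := hcon _ ih
      push_cast
      rwa [← sub_sub]
  obtain ⟨n, hn⟩ := exists_nat_gt d
  linarith [(hall n).nonneg]

/-- Any real `c` above the dimension serves: the limsup gives `dim V ^ n ≤ n ^ c` for large `n`. -/
theorem exists_of_gkdim_lt_top (h : GKdim k R < ⊤) : ∃ d, HasGrowthBound k R d := by
  obtain ⟨c, hc, -⟩ := EReal.lt_iff_exists_real_btwn.1 h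
  refine ⟨c, fun V hV => ?_⟩
  have h1 : limsup (fun n : ℕ =>
      ((Real.logb (n : ℝ) (Module.finrank k ↥(V ^ n) : ℝ) : ℝ) : EReal)) atTop < (c : EReal) :=
    lt_of_le_of_lt (le_iSup (fun V : {V : Submodule k R // FiniteDimensional k V} =>
      limsup (fun n : ℕ =>
        ((Real.logb (n : ℝ) (Module.finrank k ↥(V.1 ^ n) : ℝ) : ℝ) : EReal)) atTop) ⟨V, hV⟩) hc
  obtain ⟨M, hM⟩ := eventually_atTop.1 (eventually_lt_of_limsup_lt h1)
  have hpos (n : ℕ) (hn : 1 ≤ n) : (0 : ℝ) < (n : ℝ) ^ c :=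
    Real.rpow_pos_of_pos (by exact_mod_cast hn) c
  -- The sum absorbs the finitely many small `n`, and the `1` covers the rest. The cutoff `M + 2`
  -- ensures that the base of the logarithm exceeds `1`.
  refine ⟨1 + ∑ n ∈ Finset.range (M + 2),
    (Module.finrank k ↥(V ^ n) : ℝ) / (n : ℝ) ^ c, fun n hn => ?_⟩
  have hnn (i : ℕ) : 0 ≤ (Module.finrank k ↥(V ^ i) : ℝ) / (i : ℝ) ^ c := by positivity
  by_cases hnM : n < M + 2
  · rw [← div_le_iff₀ (hpos n hn)]
    have := Finset.single_le_sum (fun i _ => hnn i) (Finset.mem_range.2 hnM)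
    linarith
  · have h2 := EReal.coe_lt_coe_iff.1 (hM n (by omega))
    have h3 : (Module.finrank k ↥(V ^ n) : ℝ) ≤ (n : ℝ) ^ c := by
      rcases Nat.eq_zero_or_pos (Module.finrank k ↥(V ^ n)) with h0 | h0
      · rw [h0, Nat.cast_zero]
        exact (hpos n hn).le
      · exact ((Real.logb_lt_iff_lt_rpow (by exact_mod_cast (by omega : 1 < n))
          (by exact_mod_cast h0)).1 h2).le
    refine h3.trans (le_mul_of_one_le_left (hpos n hn).le ?_)
    linarith [Finset.sum_nonneg fun i (_ : i ∈ Finset.range (M + 2)) => hnn i]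

end HasGrowthBound

/-! ### Upper bound for the growth of an Ore extension -/

namespace IsOreExtension

variable {k R S : Type*} [Field k] [Ring R] [Algebra k R] [Ring S] [Algebra k S]
  {ι : R →ₐ[k] S} {t : S} {σ : R ≃ₐ[k] R} {δ : R →ₗ[k] R} {d : ℝ}

theorem exists_mem_degreeLT (h : IsOreExtension ι t σ δ) (x : S) : ∃ n, x ∈ h.degreeLT n := by
  by_cases hx : x = 0
  · exact ⟨0, hx ▸ zero_mem _⟩
  · obtain ⟨n, hn, -⟩ := h.exists_leading hx
    exact ⟨_, hn⟩

theorem finiteType [hR : Algebra.FiniteType k R] (h : IsOreExtension ι t σ δ) :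
    Algebra.FiniteType k S := by
  classical
  obtain ⟨s, hs⟩ := hR.out
  refine ⟨⟨insert t (s.image ι), ?_⟩⟩
  rw [eq_top_iff]
  intro x _
  obtain ⟨n, hn⟩ := h.exists_mem_degreeLT x
  rw [h.eq_sum_of_mem_degreeLT hn]
  refine sum_mem fun i _ => mul_mem ?_ (pow_mem (Algebra.subset_adjoin (by simp)) i)
  have h1 : ι (h.coeff i x) ∈ (Algebra.adjoin k (s : Set R)).map ι :=
    ⟨_, hs ▸ Algebra.mem_top, rfl⟩
  rw [AlgHom.map_adjoin] at h1
  exact Algebra.adjoin_mono (by simp) h1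

/-- Since `V` is `σ`-stable, moving `t` past `V` gives only `V * t` and the correction `δ(V)`. The
cost `m` is therefore independent of `a`. -/
theorem pair_mul_map_pow_le (h : IsOreExtension ι t σ δ) {V : Submodule k R} (h1 : 1 ≤ V)
    (hσ : ∀ v ∈ V, σ v ∈ V) {m : ℕ} (hδ : V.map δ ≤ V ^ m) (a : ℕ) :
    Submodule.span k {1, t} * V.map ι.toLinearMap ^ a ≤
      V.map ι.toLinearMap ^ (a + m) * Submodule.span k {1, t} := by
  set V' := V.map ι.toLinearMap
  set T := Submodule.span k {1, t}
  have h1' : 1 ≤ V' := Submodule.one_le.2 ⟨1, Submodule.one_le.1 h1, map_one ι⟩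
  have hT1 : 1 ≤ T := Submodule.one_le.2 (Submodule.subset_span (by simp))
  have ht : t ∈ T := Submodule.subset_span (by simp)
  have hbase : T * V' ≤ V' * T + V' ^ m := by
    rw [Submodule.mul_le]
    intro x hx y hy
    obtain ⟨a, b, rfl⟩ := Submodule.mem_span_pair.1 hx
    obtain ⟨v, hv, rfl⟩ := hy
    have hιv : ι v ∈ V' := ⟨v, hv, rfl⟩
    change (a • 1 + b • t) * ι v ∈ V' * T + V' ^ m
    rw [add_mul, smul_mul_assoc, smul_mul_assoc, one_mul, h.mul_eq]
    refine add_mem (Submodule.smul_mem _ _ (Submodule.mem_sup_left ?_))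
      (Submodule.smul_mem _ _ (add_mem (Submodule.mem_sup_left ?_) (Submodule.mem_sup_right ?_)))
    · simpa using Submodule.mul_mem_mul hιv (Submodule.one_le.1 hT1)
    · exact Submodule.mul_mem_mul ⟨σ v, hσ v hv, rfl⟩ ht
    · rw [← Submodule.map_pow]
      exact ⟨δ v, hδ ⟨v, hv, rfl⟩, rfl⟩
  have hind : T * V' ^ a ≤ V' ^ a * T + V' ^ (a + m) := by
    induction a with
    | zero => simp
    | succ a ih =>
      calc T * V' ^ (a + 1) = T * V' ^ a * V' := by rw [pow_succ, mul_assoc]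
        _ ≤ (V' ^ a * T + V' ^ (a + m)) * V' := by gcongr
        _ = V' ^ a * (T * V') + V' ^ (a + 1 + m) := by
            rw [add_mul, mul_assoc, ← pow_succ, Nat.add_right_comm]
        _ ≤ V' ^ a * (V' * T + V' ^ m) + V' ^ (a + 1 + m) := by gcongr
        _ = V' ^ (a + 1) * T + (V' ^ (a + m) + V' ^ (a + 1 + m)) := by
            rw [mul_add, ← mul_assoc, ← pow_succ, ← pow_add, add_assoc]
        _ ≤ V' ^ (a + 1) * T + V' ^ (a + 1 + m) := by
            gcongr
            exact sup_le (pow_le_pow_right₀ h1' (by omega)) le_rfl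
  refine hind.trans (sup_le ?_ ?_)
  · gcongr
    omega
  · exact le_mul_of_one_le_right' hT1

theorem pair_pow_mul_map_pow_le (h : IsOreExtension ι t σ δ) {V : Submodule k R} (h1 : 1 ≤ V)
    (hσ : ∀ v ∈ V, σ v ∈ V) {m : ℕ} (hδ : V.map δ ≤ V ^ m) (a p : ℕ) :
    Submodule.span k {1, t} ^ p * V.map ι.toLinearMap ^ a ≤
      V.map ι.toLinearMap ^ (a + p * m) * Submodule.span k {1, t} ^ p := by
  induction p with
  | zero => simp
  | succ p ih =>
    set V' := V.map ι.toLinearMap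
    set T := Submodule.span k {1, t}
    calc T ^ (p + 1) * V' ^ a = T * (T ^ p * V' ^ a) := by rw [pow_succ', mul_assoc]
      _ ≤ T * (V' ^ (a + p * m) * T ^ p) := by gcongr
      _ = T * V' ^ (a + p * m) * T ^ p := by rw [mul_assoc]
      _ ≤ V' ^ (a + p * m + m) * T * T ^ p := by
          exact mul_le_mul_left (h.pair_mul_map_pow_le h1 hσ hδ _) _
      _ = V' ^ (a + (p + 1) * m) * T ^ (p + 1) := by
          rw [mul_assoc, ← pow_succ', Nat.succ_mul, add_assoc]

/-- Each new block adds one factor of `V`, and its `p` factors `span {1, t}` cost `m` each to cross.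
Both exponents thus stay linear in `N`. -/
theorem map_mul_pair_pow_pow_le (h : IsOreExtension ι t σ δ) {V : Submodule k R} (h1 : 1 ≤ V)
    (hσ : ∀ v ∈ V, σ v ∈ V) {m : ℕ} (hδ : V.map δ ≤ V ^ m) (p N : ℕ) :
    (V.map ι.toLinearMap * Submodule.span k {1, t} ^ p) ^ N ≤
      V.map ι.toLinearMap ^ ((1 + p * m) * N) * Submodule.span k {1, t} ^ (p * N) := by
  induction N with
  | zero => simp
  | succ N ih =>
    set V' := V.map ι.toLinearMap
    set T := Submodule.span k {1, t}
    set b := 1 + p * m with hb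
    calc (V' * T ^ p) ^ (N + 1) = V' * T ^ p * (V' * T ^ p) ^ N := pow_succ' _ _
      _ ≤ V' * T ^ p * (V' ^ (b * N) * T ^ (p * N)) := by gcongr
      _ = V' * (T ^ p * V' ^ (b * N)) * T ^ (p * N) := by simp only [mul_assoc]
      _ ≤ V' * (V' ^ (b * N + p * m) * T ^ p) * T ^ (p * N) := by
          exact mul_le_mul_left (mul_le_mul_right (h.pair_pow_mul_map_pow_le h1 hσ hδ _ _) _) _
      _ = V' ^ (b * (N + 1)) * T ^ (p * (N + 1)) := by
          rw [← mul_assoc, ← pow_succ', mul_assoc, ← pow_add]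
          congr 2
          · rw [hb]; ring
          · ring

/-- A finite dimensional subspace of an Ore extension with locally algebraic automorphism lies in
`V * span {1, t} ^ p` for a well-behaved subspace `V` of the coefficient ring. -/
theorem exists_stable_subspace [hR : Algebra.FiniteType k R] (h : IsOreExtension ι t σ δ)
    (hσ : IsLocallyAlgebraic σ) (W : Submodule k S) [FiniteDimensional k W] :
    ∃ (V : Submodule k R) (p m : ℕ), FiniteDimensional k V ∧ 1 ≤ V ∧ (∀ v ∈ V, σ v ∈ V) ∧
      V.map δ ≤ V ^ m ∧ W ≤ V.map ι.toLinearMap * Submodule.span k {1, t} ^ p := by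
  classical
  obtain ⟨s, hs⟩ := hR.out
  obtain ⟨w, rfl⟩ := Module.Finite.iff_fg.1 ‹FiniteDimensional k W›
  choose n hn using h.exists_mem_degreeLT
  let p := w.sup n
  let c : Finset R := w.biUnion fun x => (Finset.range p).image fun i => h.coeff i x
  -- The coefficients `c` place `W` in the product, and the generators `s` force `δ(V)` into some
  -- power of `V`.
  obtain ⟨V, hle, hfin, hV⟩ := hσ (Submodule.span k ↑(insert 1 (s ∪ c)))
    (FiniteDimensional.span_finset k _)
  have hsub : (↑(insert 1 (s ∪ c)) : Set R) ⊆ V := Submodule.span_le.1 hle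
  have h1 : 1 ≤ V := Submodule.one_le.2 (hsub (by simp))
  have hgen : Algebra.adjoin k (V : Set R) = ⊤ := by
    rw [eq_top_iff, ← hs]
    exact Algebra.adjoin_mono fun x hx => hsub (by
      have : x ∈ s := hx
      simp [this])
  obtain ⟨m, hm⟩ := Submodule.exists_le_pow_of_adjoin_eq_top h1 hgen (V.map δ)
  refine ⟨V, p, m, hfin, h1, hV, hm, Submodule.span_le.2 fun x hx => ?_⟩
  have hxp : x ∈ h.degreeLT p := h.degreeLT_mono (Finset.le_sup (f := n) hx) (hn x)
  have hT1 : 1 ≤ Submodule.span k {1, t} :=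
    Submodule.one_le.2 (Submodule.subset_span (by simp))
  rw [h.eq_sum_of_mem_degreeLT hxp]
  refine sum_mem fun i hi => Submodule.mul_mem_mul ⟨h.coeff i x, hsub ?_, rfl⟩
    (pow_le_pow_right₀ hT1 (Finset.mem_range.1 hi).le
      (Submodule.pow_mem_pow _ (Submodule.subset_span (by simp)) i))
  rw [Finset.mem_coe, Finset.mem_insert, Finset.mem_union]
  exact Or.inr (Or.inr (Finset.mem_biUnion.2 ⟨x, hx, Finset.mem_image_of_mem _ hi⟩))

/-- An Ore extension of a finitely generated algebra with locally algebraic automorphism raises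
the growth by at most one. -/
theorem hasGrowthBound [Algebra.FiniteType k R] (h : IsOreExtension ι t σ δ)
    (hσ : IsLocallyAlgebraic σ) (hR : HasGrowthBound k R d) : HasGrowthBound k S (d + 1) := by
  intro W hW
  obtain ⟨V, p, m, hfin, h1, hV, hδ, hle⟩ := h.exists_stable_subspace hσ W
  obtain ⟨C, hC⟩ := hR V hfin
  set b := 1 + p * m with hb
  refine ⟨C * (b : ℝ) ^ d * (p + 1), fun N hN => ?_⟩
  have hN0 : (0 : ℝ) < N := by exact_mod_cast hN
  have hN1 : (1 : ℝ) ≤ N := by exact_mod_cast hN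
  set T := Submodule.span k {1, t}
  have hT : FiniteDimensional k T := FiniteDimensional.span_of_finite k (by simp)
  have hTp : FiniteDimensional k ↥(T ^ (p * N)) := Submodule.finiteDimensional_pow _ _
  have hVp : FiniteDimensional k ↥(V ^ (b * N)) := Submodule.finiteDimensional_pow _ _
  have hWN : W ^ N ≤ (V ^ (b * N)).map ι.toLinearMap * T ^ (p * N) := by
    rw [Submodule.map_pow]
    exact (pow_le_pow_left' hle N).trans (h.map_mul_pair_pow_pow_le h1 hV hδ p N)
  have : FiniteDimensional k ↥((V ^ (b * N)).map ι.toLinearMap * T ^ (p * N)) :=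
    Submodule.finiteDimensional_mul _ _
  have hrank : Module.finrank k ↥(W ^ N) ≤ Module.finrank k ↥(V ^ (b * N)) * (p * N + 1) :=
    (Submodule.finrank_mono hWN).trans <| (Submodule.finrank_mul_le _ _).trans <|
      Nat.mul_le_mul (Submodule.finrank_map_le _ _) (Submodule.finrank_span_one_pair_pow_le t _)
  calc (Module.finrank k ↥(W ^ N) : ℝ)
      ≤ Module.finrank k ↥(V ^ (b * N)) * (p * N + 1) := by exact_mod_cast hrank
    _ ≤ Module.finrank k ↥(V ^ (b * N)) * ((p + 1) * N) := by
        gcongr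
        linarith
    _ ≤ C * ((b * N : ℕ) : ℝ) ^ d * ((p + 1) * N) := by
        gcongr
        exact hC _ (Nat.mul_pos (by omega) hN)
    _ = C * (b : ℝ) ^ d * (p + 1) * (N : ℝ) ^ (d + 1) := by
        rw [Nat.cast_mul, Real.mul_rpow (Nat.cast_nonneg _) hN0.le, Real.rpow_add_one hN0.ne']
        ring

end IsOreExtension

/-! ### Passing along the chain of an iterated Ore extension -/

namespace IteratedOreExtension

variable {k A Y : Type*} [Field k] [Ring A] [Algebra k A] [Ring Y] [Algebra k Y] {n : ℕ} {d : ℝ}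

theorem range_le_chain (E : IteratedOreExtension k A Y n) (i : Fin (n + 1)) :
    E.ι.range ≤ E.chain i := by
  induction i using Fin.induction with
  | zero => exact E.chain_zero.ge
  | succ i ih => exact ih.trans (E.chain_le i)

theorem mem_range_inclusion_iff (E : IteratedOreExtension k A Y n) (i : Fin n)
    (x : E.chain i.succ) :
    x ∈ (Subalgebra.inclusion (E.chain_le i)).range ↔ (x : Y) ∈ E.chain i.castSucc :=
  ⟨by rintro ⟨y, rfl⟩; exact y.2, fun hx => ⟨⟨x, hx⟩, rfl⟩⟩

/-- The base algebra of an iterated Ore extension, as the first member of the chain. -/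
noncomputable def equivChainZero (E : IteratedOreExtension k A Y n) : A ≃ₐ[k] E.chain 0 :=
  (AlgEquiv.ofInjective E.ι E.ι_injective).trans (Subalgebra.equivOfEq _ _ E.chain_zero.symm)

/-- An iterated Ore extension, as the last member of the chain. -/
noncomputable def equivChainLast (E : IteratedOreExtension k A Y n) :
    E.chain (Fin.last n) ≃ₐ[k] Y :=
  (Subalgebra.equivOfEq _ _ E.chain_last).trans Subalgebra.topEquiv

theorem noZeroDivisors_chain [NoZeroDivisors A] (E : IteratedOreExtension k A Y n)
    (i : Fin (n + 1)) : NoZeroDivisors (E.chain i) := by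
  induction i using Fin.induction with
  | zero => exact E.equivChainZero.symm.toMulEquiv.noZeroDivisors A
  | succ i ih => exact (E.isOre i).noZeroDivisors

theorem noZeroDivisors [NoZeroDivisors A] (E : IteratedOreExtension k A Y n) :
    NoZeroDivisors Y :=
  have := E.noZeroDivisors_chain (Fin.last n)
  E.equivChainLast.symm.toMulEquiv.noZeroDivisors _

/-- The base domain of an iterated Ore extension is closed under taking factors. -/
theorem factors_mem_range [NoZeroDivisors A] (E : IteratedOreExtension k A Y n) {x y : Y}
    (hxy : x * y ∈ E.ι.range) (hne : x * y ≠ 0) : x ∈ E.ι.range ∧ y ∈ E.ι.range := by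
  rw [← E.chain_zero]
  refine (fun i => ?_ : ∀ i, x ∈ E.chain i ∧ y ∈ E.chain i) 0
  induction i using Fin.reverseInduction with
  | last => rw [E.chain_last]; exact ⟨Algebra.mem_top, Algebra.mem_top⟩
  | cast i ih =>
    have := E.noZeroDivisors_chain i.castSucc
    have h := (E.isOre i).factors_mem_range (x := ⟨x, ih.1⟩) (y := ⟨y, ih.2⟩)
      ((E.mem_range_inclusion_iff i _).2 (E.range_le_chain _ hxy))
      (fun h0 => hne (congrArg Subtype.val h0))
    exact ⟨(E.mem_range_inclusion_iff i _).1 h.1, (E.mem_range_inclusion_iff i _).1 h.2⟩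

/-- Powers of an element outside the base domain are left independent over it. -/
theorem eq_zero_of_sum_pow_eq_zero [IsDomain A] (E : IteratedOreExtension k A Y n) {f : Y}
    (hf : f ∉ E.ι.range) (c : ℕ → A) (N : ℕ)
    (hc : ∑ i ∈ Finset.range N, E.ι (c i) * f ^ i = 0) : ∀ i < N, c i = 0 := by
  -- At a step where `f` first enters the chain it has positive degree over a coefficient ring
  -- containing `A`.
  obtain ⟨j, hj, hj'⟩ : ∃ j : Fin n, f ∈ E.chain j.succ ∧ f ∉ E.chain j.castSucc := by
    by_contra! hcon
    refine hf (E.chain_zero ▸ (fun i => ?_ : ∀ i, f ∈ E.chain i) 0)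
    induction i using Fin.reverseInduction with
    | last => rw [E.chain_last]; exact Algebra.mem_top
    | cast i ih => exact hcon i ih
  have hY : Nontrivial Y := E.ι_injective.nontrivial
  have := E.noZeroDivisors_chain j.castSucc
  have : IsDomain (E.chain j.castSucc) := NoZeroDivisors.to_isDomain _
  let c' : ℕ → E.chain j.castSucc := fun i => ⟨E.ι (c i), E.range_le_chain _ ⟨c i, rfl⟩⟩
  have h := (E.isOre j).eq_zero_of_sum_pow_eq_zero (f := ⟨f, hj⟩)
    (fun h => hj' ((E.mem_range_inclusion_iff j _).1 h)) c' N (Subtype.ext (by simpa [c'] using hc))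
  intro i hi
  have h0 : E.ι (c i) = 0 := congrArg Subtype.val (h i hi)
  exact (map_eq_zero_iff _ E.ι_injective).1 h0

theorem hasGrowthBound [hA : Algebra.FiniteType k A] (E : IteratedOreExtension k A Y n)
    (hσ : ∀ i, IsLocallyAlgebraic (E.σ i)) (h : HasGrowthBound k A d) :
    HasGrowthBound k Y (d + n) := by
  -- Finite generation is carried along because the one-step bound needs it of each coefficient
  -- ring.
  have hchain (i : Fin (n + 1)) :
      Algebra.FiniteType k (E.chain i) ∧ HasGrowthBound k (E.chain i) (d + (i : ℕ)) := by
    induction i using Fin.induction with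
    | zero =>
      refine ⟨hA.equiv E.equivChainZero, ?_⟩
      simpa using h.of_injective E.equivChainZero.symm.toAlgHom E.equivChainZero.symm.injective
    | succ i ih =>
      have := ih.1
      refine ⟨(E.isOre i).finiteType, ?_⟩
      have := (E.isOre i).hasGrowthBound (hσ i) ih.2
      simpa [add_assoc] using this
  exact (hchain (Fin.last n)).2.of_injective E.equivChainLast.symm.toAlgHom
    E.equivChainLast.symm.injective

/-- Freeness makes the powers of each `t i` independent over the previous member, so every step down
lowers the exponent by one. -/
theorem hasGrowthBound_base (E : IteratedOreExtension k A Y n)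
    (h : HasGrowthBound k Y (d + n)) : HasGrowthBound k A d := by
  have hchain (i : Fin (n + 1)) : HasGrowthBound k (E.chain i) (d + (i : ℕ)) := by
    induction i using Fin.reverseInduction with
    | last => exact h.of_injective E.equivChainLast.toAlgHom E.equivChainLast.injective
    | cast i ih =>
      refine HasGrowthBound.of_independent_powers _ _ (E.isOre i).eq_zero_of_sum_eq_zero ?_
      simpa [add_assoc] using ih
  have h0 := hchain 0
  simp only [Fin.val_zero, Nat.cast_zero, add_zero] at h0
  exact h0.of_injective E.equivChainZero.toAlgHom E.equivChainZero.injective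

end IteratedOreExtension

/-! ### Divisor subalgebras and cancellation -/

/-- An injective homomorphism maps the divisor subalgebra of `1` into every subalgebra of the
target that is closed under taking factors. -/
theorem map_mem_of_mem_divisorSubalgebra {k A Y : Type*} [Field k] [Ring A] [Algebra k A]
    [Ring Y] [Algebra k Y] (φ : A →ₐ[k] Y) (hφ : Function.Injective φ) (B : Subalgebra k Y)
    (hB : ∀ x y : Y, x * y ∈ B → x * y ≠ 0 → x ∈ B ∧ y ∈ B) {a : A}
    (ha : a ∈ divisorSubalgebra k ({1} : Set A)) : φ a ∈ B := by
  obtain ⟨m, hm⟩ := Set.mem_iUnion.1 ha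
  induction m generalizing a with
  | zero =>
    obtain rfl : a = 1 := hm
    rw [map_one]
    exact one_mem B
  | succ m ih =>
    have hle : Algebra.adjoin k (subwords (divisorStep k ({1} : Set A) m)) ≤ B.comap φ := by
      refine Algebra.adjoin_le ?_
      rintro g ⟨f, hf, hf0, a, b, rfl⟩
      have h1 : φ a * φ g * φ b ∈ B := by
        rw [← map_mul, ← map_mul]
        exact ih (Set.mem_iUnion.2 ⟨m, hf⟩) hf
      have h2 : φ a * φ g * φ b ≠ 0 := by
        rw [← map_mul, ← map_mul]
        exact (map_ne_zero_iff φ hφ).2 hf0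
      -- Closure under factors strips off `φ b`, then `φ a`.
      exact (hB _ _ (hB _ _ h1 h2).1 (left_ne_zero_of_mul h2)).2
    exact hle hm

theorem IsLocallyAlgebraic.refl {k A : Type*} [Field k] [Ring A] [Algebra k A] :
    IsLocallyAlgebraic (AlgEquiv.refl : A ≃ₐ[k] A) :=
  fun V hV => ⟨V, le_rfl, hV, fun _ hw => hw⟩

theorem isStronglySigmaAlgebraicallyCancellative_of_divisorSubalgebra_eq_top
    (k : Type uk) (A : Type uA) [Field k] [Ring A] [IsDomain A] [Algebra k A]
    [Algebra.FiniteType k A] (hGK : GKdim k A < ⊤)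
    (hD : divisorSubalgebra k ({1} : Set A) = ⊤) :
    IsStronglySigmaAlgebraicallyCancellative.{uk, uA, uA', uY, uY'} k A := by
  rintro n - A' _ _ Y _ _ Y' _ _ E E' hσ - ⟨φ⟩
  have hY := E.noZeroDivisors
  have hA' : NoZeroDivisors A' :=
    (φ.symm.injective.comp E'.ι_injective).noZeroDivisors (φ.symm.toAlgHom.comp E'.ι)
      (map_zero _) (map_mul _)
  let ψ : A →ₐ[k] Y' := φ.toAlgHom.comp E.ι
  have hψ : Function.Injective ψ := φ.injective.comp E.ι_injective
  have hle : ψ.range ≤ E'.ι.range := by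
    rintro _ ⟨a, rfl⟩
    exact map_mem_of_mem_divisorSubalgebra ψ hψ _ (fun x y => E'.factors_mem_range)
      (hD ▸ Algebra.mem_top)
  have hge : E'.ι.range ≤ ψ.range := by
    rintro _ ⟨f, rfl⟩
    by_contra hf
    obtain ⟨d₀, hd₀⟩ := HasGrowthBound.exists_of_gkdim_lt_top hGK
    obtain ⟨d, hd, hd'⟩ := hd₀.exists_sharp
    -- Up `n` steps from `A` to `Y`, across the isomorphism, and down `n` steps to `A'`.
    have h1 : HasGrowthBound k A' d := E'.hasGrowthBound_base
      ((E.hasGrowthBound hσ hd).of_injective φ.symm.toAlgHom φ.symm.injective)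
    let e := AlgEquiv.ofInjective E'.ι E'.ι_injective
    -- The inclusion `A ⊆ A'` under the identification of `Y` with `Y'`.
    let χ : A →ₐ[k] A' :=
      e.symm.toAlgHom.comp ((Subalgebra.inclusion hle).comp ψ.rangeRestrict)
    have hχ (a : A) : φ.symm (E'.ι (χ a)) = E.ι a := by
      have h2 : e (χ a) = Subalgebra.inclusion hle (ψ.rangeRestrict a) := e.apply_symm_apply _
      have h3 : E'.ι (χ a) = φ (E.ι a) := congrArg Subtype.val h2
      rw [h3, φ.symm_apply_apply]
    -- Independence of the powers of `f` over `A` is checked in `Y`, where `f` lies outside the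
    -- base.
    refine hd' (HasGrowthBound.of_independent_powers χ f (fun c N hc => ?_) (by simpa using h1))
    refine E.eq_zero_of_sum_pow_eq_zero (f := φ.symm (E'.ι f)) ?_ c N ?_
    · rintro ⟨a, ha⟩
      refine hf ⟨a, ?_⟩
      change φ (E.ι a) = _
      exact (φ.eq_symm_apply.1 ha)
    · have h4 := congrArg (fun x => φ.symm (E'.ι x)) hc
      simpa [hχ] using h4
  exact ⟨(AlgEquiv.ofInjective ψ hψ).trans <|
    (Subalgebra.equivOfEq _ _ (le_antisymm hle hge)).trans
      (AlgEquiv.ofInjective E'.ι E'.ι_injective).symm⟩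

theorem theorem0p9 (k : Type uk) (A : Type uA) [Field k] [Ring A] [IsDomain A] [Algebra k A]
    [Algebra.FiniteType k A] (hGK : GKdim k A < ⊤)
    (hD : divisorSubalgebra k ({1} : Set A) = ⊤) :
    IsStronglySigmaAlgebraicallyCancellative.{uk, uA, uA', uY, uY'} k A ∧
      IsStronglyDeltaCancellative.{uk, uA, uA', uY, uY'} k A := by
  have h := isStronglySigmaAlgebraicallyCancellative_of_divisorSubalgebra_eq_top.{uk, uA, uA', uY,
    uY'} k A hGK hD
  refine ⟨h, fun n hn A' _ _ Y _ _ Y' _ _ E E' hσ hσ' => h n hn A' Y Y' E E' ?_ ?_⟩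
  · exact fun i => hσ i ▸ IsLocallyAlgebraic.refl
  · exact fun i => hσ' i ▸ IsLocallyAlgebraic.refl
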